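/- Let $R$ be an irreducible reduced crystallographic root system in a finite-dimensional Euclidean space $V$, with Weyl group $W$, a chosen base $\{\alpha_i\}_{i\in I}$, positive roots $R_+$, negative roots $R_-=-R_+$ and coroots $\alpha^\vee=2\alpha/\langle\alpha,\alpha\rangle$. Put $R_+^\vee=\{\alpha^\vee:\alpha\in R_+\}$, $R_-^\vee=-R_+^\vee$. Let $P_+$ be the set of $\mu\in V$ such that $\langle\alpha_i^\vee,\mu\rangle\in\mathbb Z_{\ge 0}$ for all $i$, let $\rho=\frac12\sum_{\alpha\in R_+}\alpha$ and $P_{++}=P_++\rho$. For $w\in W$ let $R_w^\vee=R_+^\vee\cap w^{-1}R_-^\vee$ and $l(w)=|R_w^\vee|$; write $R_w$ for the corresponding set of roots $\alpha$. For $\mu\in P_+$ let $W(\mu)$ be its $W$-orbit, and for $\tilde\mu\in W(\mu)$ let $w_{\tilde\mu}$ be the shortest element of $W$ with $w_{\tilde\mu}^{-1}(\tilde\mu)\in P_+$. Fix $\mu\in P_+$. (1) Let $k_\alpha\in\mathbb R$ $(\alpha\in R)$ satisfy $k_{w(\alpha)}=k_\alpha$ for all $w\in W$, and let $\rho_k=\frac12\sum_{\alpha\in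 R_+}k_\alpha\alpha$. For either choice of the sign (upper signs throughout or lower signs throughout), if $\langle\alpha^\vee,\mu+\rho_k\rangle\pm k_\alpha\neq 0$ for all $\alpha\in R_+$, then $$\sum_{\tilde\mu\in W(\mu)}\ \prod_{\alpha^\vee\in R_{w_{\tilde\mu}}^\vee}\frac{\langle\alpha^\vee,\mu+\rho_k\rangle\mp k_\alpha}{\langle\alpha^\vee,\mu+\rho_k\rangle\pm k_\alpha}=|W|\prod_{\alpha\in R_+}\frac{\langle\alpha^\vee,\mu+\rho_k\rangle}{\langle\alpha^\vee,\mu+\rho_k\rangle\pm k_\alpha}.$$ Moreover, if all $k_\alpha>0$, then $\langle\alpha^\vee,\mu+\rho_k\rangle+k_\alpha>0$ for all $\alpha\in R_+$; and if all $k_\alpha\ge0$ and $\mu\in P_{++}$, then $\langle\alpha^\vee,\mu+\rho_k\rangle+k_\alpha>0$ and $\langle\alpha^\vee,\mu+\rho_k\rangle-k_\alpha>0$ for all $\alpha\in R_+$. (2) Let $K$ be a field of characteristic $0$, let $q\in K^\times$, and let $u_\alpha\in K^\times$ $(\alpha\in R)$ satisfy $u_{w(\alpha)}=u_\alpha$ for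 all $w\in W$. Put $t_\alpha=u_\alpha^2$ and, for $\alpha\in R$, $$q^{\langle\alpha^\vee,\mu+\rho_k\rangle}:=q^{\langle\alpha^\vee,\mu\rangle}\prod_{\beta\in R_+}u_\beta^{\langle\alpha^\vee,\beta\rangle}$$ (for real $q>0$ and $t_\alpha=q^{k_\alpha}$, $u_\alpha=q^{k_\alpha/2}$ with real $k_\alpha$, this is the usual power), and let $q^{-\langle\alpha^\vee,\mu+\rho_k\rangle}$ be its inverse. Let $W(t)=\sum_{w\in W}\prod_{\alpha\in R_w}t_\alpha$. For either choice of the sign, if $1-t_\alpha q^{\pm\langle\alpha^\vee,\mu+\rho_k\rangle}\ne0$ for all $\alpha\in R_+$, then $$\sum_{\tilde\mu\in W(\mu)}\ \prod_{\alpha^\vee\in R_{w_{\tilde\mu}}^\vee}\frac{t_\alpha\bigl(1-t_\alpha^{-1}q^{\pm\langle\alpha^\vee,\mu+\rho_k\rangle}\bigr)}{1-t_\alpha q^{\pm\langle\alpha^\vee,\mu+\rho_k\rangle}}=W(t)\prod_{\alpha\in R_+}\frac{1-q^{\pm\langle\alpha^\vee,\mu+\rho_k\rangle}}{1-t_\alpha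 q^{\pm\langle\alpha^\vee,\mu+\rho_k\rangle}}.$$ -/

import Mathlib

/-!
Conventions.  `P` is a root system over `ℝ`: `P.root i` is the root `α` with index `i`, the linear
form `P.coroot' i` is `⟨α^∨, ·⟩`, and the Weyl group `P.weylGroup` acts on the root space `M`
and on the set `ι` of indices of roots, with `P.root (w • i) = w • P.root i`.
-/

namespace HeckmanOpdam

variable {ι M N : Type*} [AddCommGroup M] [Module ℝ M] [AddCommGroup N] [Module ℝ N]
  {P : RootPairing ι ℝ M N}

/-- A Weyl group element is determined by the permutation of the roots that it induces. -/
theorem weylGroupToPerm_injective [P.IsRootSystem] :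
    Function.Injective P.weylGroupToPerm := by
  intro g h hgh
  apply Subtype.ext
  apply RootPairing.Equiv.weightHom_injective P
  apply LinearEquiv.toLinearMap_injective
  refine LinearMap.ext_on (RootPairing.IsRootSystem.span_root_eq_top (P := P)) ?_
  rintro _ ⟨i, rfl⟩
  have h1 := P.weylGroup_apply_root g i
  have h2 := P.weylGroup_apply_root h i
  rw [hgh, ← h2] at h1
  exact h1

instance [Finite ι] [P.IsRootSystem] : Finite P.weylGroup :=
  Finite.of_injective _ weylGroupToPerm_injective

noncomputable instance [Finite ι] [P.IsRootSystem] : Fintype P.weylGroup :=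
  Fintype.ofFinite _

/-- The orbit `W(μ)` of a vector under the Weyl group. -/
noncomputable def orbitFinset [Finite ι] (P : RootPairing ι ℝ M N) [P.IsRootSystem] (μ : M) :
    Finset M :=
  (Set.finite_range fun w : P.weylGroup => w • μ).toFinset

/-- `μ ∈ P_+`: a combination of the fundamental weights with coefficients in `ℤ_{≥ 0}`, that is,
`⟨α_i^∨, μ⟩` is a nonnegative integer for every simple root `α_i`. -/
def IsDominantWeight (b : P.Base) (μ : M) : Prop :=
  ∀ i ∈ b.support, ∃ n : ℕ, P.coroot' i μ = n

open scoped Classical in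
/-- The (indices of the) positive roots `R_+`. -/
noncomputable def posRoots [Fintype ι] (b : P.Base) : Finset ι :=
  {i | b.IsPos i}

/-- `ρ_k = ½ ∑_{α ∈ R_+} k_α α`. -/
noncomputable def rho [Fintype ι] (b : P.Base) (k : ι → ℝ) : M :=
  (1 / 2 : ℝ) • ∑ i ∈ posRoots b, k i • P.root i

/-- `μ ∈ P_{++} = P_+ + ρ`, where `ρ` is half the sum of the positive roots. -/
def IsRegularDominantWeight [Fintype ι] (b : P.Base) (μ : M) : Prop :=
  ∃ ν : M, IsDominantWeight b ν ∧ μ = ν + rho b (fun _ => 1)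

open scoped Classical in
/-- `R_w^∨ = R_+^∨ ∩ w⁻¹ R_-^∨`: the (indices of the) positive coroots made negative by `w`. A
coroot is positive exactly when the root with the same index is, and a root is negative exactly
when it is not positive. -/
noncomputable def inversions [Fintype ι] (b : P.Base) (w : P.weylGroup) : Finset ι :=
  {i | b.IsPos i ∧ ¬ b.IsPos (w • i)}

/-- The length `l(w) = |R_w^∨|`. -/
noncomputable def length [Fintype ι] (b : P.Base) (w : P.weylGroup) : ℕ :=
  (inversions b w).card

/-- `w` is a shortest element of `W` with `w⁻¹(ν) ∈ P_+`. -/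
def IsShortest [Fintype ι] (b : P.Base) (ν : M) (w : P.weylGroup) : Prop :=
  IsDominantWeight b (w⁻¹ • ν) ∧
    ∀ w' : P.weylGroup, IsDominantWeight b (w'⁻¹ • ν) → length b w ≤ length b w'

/-- `w_ν`, the shortest element of `W` with `w_ν⁻¹(ν) ∈ P_+`. -/
noncomputable def shortest [Fintype ι] (b : P.Base) (ν : M) : P.weylGroup :=
  Classical.epsilon (IsShortest b ν)

theorem shortest_spec [Fintype ι] (b : P.Base) {μ ν : M} (hμ : IsDominantWeight b μ)
    (hν : ∃ w : P.weylGroup, w • μ = ν) : IsShortest b ν (shortest b ν) := by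
  apply Classical.epsilon_spec (p := IsShortest b ν)
  obtain ⟨w, hw⟩ := hν
  have hne : {w : P.weylGroup | IsDominantWeight b (w⁻¹ • ν)}.Nonempty :=
    ⟨w, by simpa [← hw] using hμ⟩
  exact ⟨Function.argminOn (length b) _ hne,
    Function.argminOn_mem (length b) _ hne,
    fun w' hw' => Function.argminOn_le (length b) _ hw'⟩

/-- A family of parameters indexed by the roots is `W`-invariant: `k_{w(α)} = k_α`. -/
def IsInvariant {A : Type*} (P : RootPairing ι ℝ M N) (k : ι → A) : Prop :=
  ∀ (w : P.weylGroup) (i : ι), k (w • i) = k i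

/-- The Poincaré polynomial `W(t) = ∑_{w ∈ W} ∏_{α ∈ R_w} t_α`. -/
noncomputable def poincare {K : Type*} [Field K] [Fintype ι] [P.IsRootSystem] (b : P.Base)
    (t : ι → K) : K :=
  ∑ w : P.weylGroup, ∏ i ∈ inversions b w, t i

/-- The integer `⟨α^∨, μ⟩`, for a weight `μ`. -/
noncomputable def intPairing (P : RootPairing ι ℝ M N) (i : ι) (μ : M) : ℤ :=
  ⌊P.coroot' i μ⌋

/-- `q^{⟨α^∨, μ + ρ_k⟩}`, where `t_α = q^{k_α}` and `u_α` is a square root of `t_α`. Since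
`⟨α^∨, ρ_k⟩ = ½ ∑_{β ∈ R_+} k_β ⟨α^∨, β⟩`, this is
`q^{⟨α^∨, μ⟩} ∏_{β ∈ R_+} u_β^{⟨α^∨, β⟩}`. -/
noncomputable def qPow {K : Type*} [Field K] [Fintype ι] [P.IsCrystallographic] (b : P.Base)
    (q : K) (u : ι → K) (μ : M) (i : ι) : K :=
  q ^ intPairing P i μ * ∏ j ∈ posRoots b, u j ^ P.pairingIn ℤ j i

/-- `⟨α^∨, μ⟩` is an integer for all roots `α` when `μ ∈ P_+`. -/
theorem intPairing_cast (b : P.Base) {μ : M} (hμ : IsDominantWeight b μ)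
    (i : ι) : (intPairing P i μ : ℝ) = P.coroot' i μ := by
  have key : ∀ x ∈ Submodule.span ℤ (P.coroot '' b.support),
      ∃ z : ℤ, P.toLinearMap.flip x μ = z := by
    intro x hx
    induction hx using Submodule.span_induction with
    | mem x hx =>
      obtain ⟨j, hj, rfl⟩ := hx
      obtain ⟨n, hn⟩ := hμ j hj
      exact ⟨n, by simpa using hn⟩
    | zero => exact ⟨0, by simp⟩
    | add x y _ _ hx hy =>
      obtain ⟨m, hm⟩ := hx
      obtain ⟨n, hn⟩ := hy
      exact ⟨m + n, by simp_all⟩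
    | smul a x _ hx =>
      obtain ⟨m, hm⟩ := hx
      exact ⟨a * m, by rw [map_zsmul, LinearMap.smul_apply, hm]; simp⟩
  obtain ⟨z, hz⟩ := key _ (b.coroot_mem_span_int i)
  have hz' : P.coroot' i μ = z := hz
  rw [intPairing, hz', Int.floor_intCast]

/-- For real `q > 0` and `u_α = q^{k_α / 2}`, `qPow` is the real power `q^{⟨α^∨, μ + ρ_k⟩}`. -/
theorem qPow_eq_rpow [Fintype ι] [P.IsCrystallographic] (b : P.Base) {μ : M}
    (hμ : IsDominantWeight b μ) (q : ℝ) (hq : 0 < q) (k : ι → ℝ) (i : ι) :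
    qPow b q (fun j => q ^ (k j / 2)) μ i = q ^ P.coroot' i (μ + rho b k) := by
  have h1 : ∀ j, (q ^ (k j / 2)) ^ P.pairingIn ℤ j i = q ^ (k j / 2 * P.pairing j i) := by
    intro j
    rw [← P.algebraMap_pairingIn ℤ j i, ← Real.rpow_intCast, ← Real.rpow_mul hq.le]
    simp
  have h2 : P.coroot' i (rho b k) = ∑ j ∈ posRoots b, k j / 2 * P.pairing j i := by
    simp only [rho, map_smul, map_sum, Finset.smul_sum, P.root_coroot'_eq_pairing, smul_eq_mul]
    exact Finset.sum_congr rfl fun j _ => by ring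
  rw [qPow, map_add, Real.rpow_add hq, h2, Real.rpow_sum_of_pos hq, ← intPairing_cast b hμ i,
    Real.rpow_intCast]
  simp only [h1]

end HeckmanOpdam

set_option linter.unusedSectionVars false

namespace HeckmanOpdam

open RootPairing

variable {ι M N : Type*} [Fintype ι] [AddCommGroup M] [Module ℝ M] [AddCommGroup N] [Module ℝ N]
  {P : RootPairing ι ℝ M N}

theorem mem_posRoots {b : P.Base} {i : ι} : i ∈ posRoots b ↔ b.IsPos i := by
  simp [posRoots]

theorem mem_inversions {b : P.Base} {w : P.weylGroup} {i : ι} :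
    i ∈ inversions b w ↔ b.IsPos i ∧ ¬ b.IsPos (w • i) := by
  simp [inversions]

/-- The index of the negative of a root. -/
def negIdx (P : RootPairing ι ℝ M N) (i : ι) : ι := P.reflectionPerm i i

theorem root_negIdx (i : ι) : P.root (negIdx P i) = -P.root i := by
  simp [negIdx]

theorem coroot_negIdx (i : ι) : P.coroot (negIdx P i) = -P.coroot i := by
  simp [negIdx]

theorem negIdx_negIdx (i : ι) : negIdx P (negIdx P i) = i :=
  P.root.injective (by simp [root_negIdx])

theorem isPos_negIdx (b : P.Base) (i : ι) : b.IsPos (negIdx P i) ↔ ¬ b.IsPos i :=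
  Base.IsPos.neg_iff_not b i

theorem root_smul (w : P.weylGroup) (i : ι) : P.root (w • i) = w • P.root i :=
  (P.weylGroup_apply_root w i).symm

theorem smul_negIdx (w : P.weylGroup) (i : ι) : w • negIdx P i = negIdx P (w • i) :=
  P.root.injective (by rw [root_smul, root_negIdx, root_negIdx, root_smul, smul_neg])

/-- The reflection in a root, as an element of the Weyl group. -/
noncomputable abbrev refl (P : RootPairing ι ℝ M N) (i : ι) : P.weylGroup := weylGroup.ofIdx P i

theorem refl_smul_idx (i j : ι) : refl P i • j = P.reflectionPerm i j := by
  rfl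

theorem refl_smul_self (i : ι) : refl P i • i = negIdx P i := rfl

theorem refl_mul_self (i : ι) : refl P i * refl P i = 1 := by
  apply Subtype.ext
  have := Equiv.reflection_inv P i
  exact mul_eq_one_iff_eq_inv.mpr this.symm

theorem refl_inv (i : ι) : (refl P i)⁻¹ = refl P i :=
  inv_eq_of_mul_eq_one_left (refl_mul_self i)

theorem refl_smul_smul (i j : ι) : refl P i • refl P i • j = j := by
  rw [smul_smul, refl_mul_self, one_smul]

theorem root_refl_smul (i j : ι) :
    P.root (refl P i • j) = P.root j - P.pairing j i • P.root i := by
  rw [refl_smul_idx, P.root_reflectionPerm, P.reflection_apply_root]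

theorem coroot_refl_smul (i j : ι) :
    P.coroot (refl P i • j) = P.coroot j - P.pairing i j • P.coroot i := by
  rw [refl_smul_idx, P.coroot_reflectionPerm, P.coreflection_apply_coroot]

theorem coroot'_smul (w : P.weylGroup) (i : ι) (x : M) :
    P.coroot' (w • i) (w • x) = P.coroot' i x := by
  have h := LinearMap.congr_fun (Hom.weight_coweight_transpose_apply P P (P.coroot (w • i))
    (w : P.Aut).toHom) x
  rw [Hom.coroot_coweightMap_apply] at h
  have e : (w : P.Aut).toHom.indexEquiv.symm (w • i) = i :=
    (w : P.Aut).toHom.indexEquiv.symm_apply_apply i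
  rw [e] at h
  exact h

theorem pairing_smul (w : P.weylGroup) (i j : ι) :
    P.pairing (w • i) (w • j) = P.pairing i j := by
  rw [← P.root_coroot'_eq_pairing, root_smul, coroot'_smul, P.root_coroot'_eq_pairing]

/-- The action of the Weyl group on the coroot space. -/
noncomputable def coact (w : P.weylGroup) : N →ₗ[ℝ] N :=
  (↑(w⁻¹) : P.Aut).toHom.coweightMap

theorem coact_coroot (w : P.weylGroup) (i : ι) : coact w (P.coroot i) = P.coroot (w • i) := by
  rw [coact, Hom.coroot_coweightMap_apply]
  rfl

theorem weylGroup_smul_sum {κ : Type*} (w : P.weylGroup) (s : Finset κ) (f : κ → M) :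
    w • ∑ i ∈ s, f i = ∑ i ∈ s, w • f i := Finset.smul_sum

theorem weylGroup_smul_smul (w : P.weylGroup) (c : ℝ) (x : M) : w • c • x = c • w • x :=
  smul_comm (w : P.Aut) c x

theorem refl_smul (i : ι) (x : M) : refl P i • x = x - P.coroot' i x • P.root i := by
  rw [weylGroup.ofIdx_smul, Equiv.reflection_smul, P.reflection_apply]

section RootSystem

variable [P.IsRootSystem]

theorem coact_ext {f g : N →ₗ[ℝ] N} (h : ∀ i, f (P.coroot i) = g (P.coroot i)) : f = g := by
  refine LinearMap.ext_on (RootPairing.IsRootSystem.span_coroot_eq_top (P := P)) ?_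
  rintro _ ⟨i, rfl⟩
  exact h i

theorem coact_mul (v w : P.weylGroup) (y : N) : coact (v * w) y = coact v (coact w y) := by
  have : coact (v * w) = coact v ∘ₗ coact w :=
    coact_ext (P := P) fun i => by simp [coact_coroot, mul_smul]
  rw [this, LinearMap.comp_apply]

theorem coact_one (y : N) : coact (1 : P.weylGroup) y = y := by
  have : coact (1 : P.weylGroup) = LinearMap.id :=
    coact_ext (P := P) fun i => by simp [coact_coroot]
  rw [this, LinearMap.id_apply]

theorem coact_inv_coact (w : P.weylGroup) (y : N) : coact w⁻¹ (coact w y) = y := by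
  rw [← coact_mul, inv_mul_cancel, coact_one]

theorem coact_coact_inv (w : P.weylGroup) (y : N) : coact w (coact w⁻¹ y) = y := by
  rw [← coact_mul, mul_inv_cancel, coact_one]

theorem coact_refl (i : ι) (y : N) : coact (refl P i) y = y - P.root' i y • P.coroot i := by
  have : coact (refl P i) = (P.coreflection i : N →ₗ[ℝ] N) :=
    coact_ext (P := P) fun j => by
      rw [coact_coroot, coroot_refl_smul, LinearEquiv.coe_coe, P.coreflection_apply_coroot]
  rw [this, LinearEquiv.coe_coe, P.coreflection_apply]

theorem idx_ext {v w : P.weylGroup} (h : ∀ i : ι, v • i = w • i) : v = w :=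
  weylGroupToPerm_injective (Equiv.ext h)

theorem refl_smul_eq_conj (w : P.weylGroup) (i : ι) :
    refl P (w • i) = w * refl P i * w⁻¹ := by
  refine idx_ext fun j => P.root.injective ?_
  obtain ⟨k, rfl⟩ := MulAction.surjective w j
  rw [mul_smul, inv_smul_smul, mul_smul, root_refl_smul, root_smul w (refl P i • k),
    root_refl_smul, smul_sub, weylGroup_smul_smul, pairing_smul, root_smul, root_smul]

end RootSystem

section Positive

variable [P.IsCrystallographic] [P.IsReduced] (b : P.Base)

theorem isPos_refl_smul {i j : ι} (hi : i ∈ b.support) (hj : b.IsPos j) (hij : j ≠ i) :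
    b.IsPos (refl P i • j) :=
  hj.reflectionPerm hi hij

theorem not_isPos_refl_smul_self {i : ι} (hi : i ∈ b.support) : ¬ b.IsPos (refl P i • i) := by
  rw [refl_smul_self, isPos_negIdx, not_not]
  exact b.isPos_of_mem_support hi

theorem eq_of_isPos_of_not_isPos_refl {i j : ι} (hi : i ∈ b.support) (hj : b.IsPos j)
    (hij : ¬ b.IsPos (refl P i • j)) : j = i := by
  by_contra h
  exact hij (isPos_refl_smul b hi hj h)

theorem abs_idx_mem (w : P.weylGroup) (i : ι) [Decidable (b.IsPos (w • i))] :
    (if b.IsPos (w • i) then w • i else negIdx P (w • i)) ∈ posRoots b := by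
  rw [mem_posRoots]
  split_ifs with h
  · exact h
  · rwa [isPos_negIdx]

/-- A product over the positive roots of a function that is invariant under `α ↦ -α` is invariant
under the Weyl group. -/
@[to_additive sum_posRoots_smul]
theorem prod_posRoots_smul {A : Type*} [CommMonoid A] (w : P.weylGroup) (f : ι → A)
    (hf : ∀ i, f (negIdx P i) = f i) :
    ∏ i ∈ posRoots b, f (w • i) = ∏ i ∈ posRoots b, f i := by
  classical
  have key : ∀ (v : P.weylGroup), ∀ i ∈ posRoots b,
      (fun j => if b.IsPos (v⁻¹ • j) then v⁻¹ • j else negIdx P (v⁻¹ • j))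
        (if b.IsPos (v • i) then v • i else negIdx P (v • i)) = i := by
    intro v i hi
    rw [mem_posRoots] at hi
    have hn : ¬ b.IsPos (negIdx P i) := by rwa [isPos_negIdx, not_not]
    by_cases h : b.IsPos (v • i)
    · simp [h, hi]
    · simp [h, smul_negIdx, hn, negIdx_negIdx]
  refine Finset.prod_bij' (fun i _ => if b.IsPos (w • i) then w • i else negIdx P (w • i))
    (fun j _ => if b.IsPos (w⁻¹ • j) then w⁻¹ • j else negIdx P (w⁻¹ • j))
    (fun i _ => abs_idx_mem b w i) (fun j _ => abs_idx_mem b w⁻¹ j)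
    (fun i hi => key w i hi) (fun j hj => by simpa only [inv_inv] using key w⁻¹ j hj) ?_
  intro i _
  split_ifs
  · rfl
  · rw [hf]

open scoped Classical in
/-- The sign of a Weyl group element: `(-1) ^ l(w)`. -/
noncomputable def sgn (w : P.weylGroup) : ℤ :=
  ∏ i ∈ posRoots b, if b.IsPos (w • i) then 1 else -1

theorem sgn_mul (v w : P.weylGroup) : sgn b (v * w) = sgn b v * sgn b w := by
  classical
  have h := prod_posRoots_smul b w
    (fun i => (if b.IsPos (v • i) then (1 : ℤ) else -1) * if b.IsPos i then 1 else -1) (by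
      intro i
      rw [smul_negIdx, isPos_negIdx, isPos_negIdx]
      split_ifs <;> simp_all)
  rw [Finset.prod_mul_distrib, Finset.prod_mul_distrib] at h
  have h1 : ∏ i ∈ posRoots b, (if b.IsPos i then (1 : ℤ) else -1) = 1 :=
    Finset.prod_eq_one fun i hi => by rw [if_pos (mem_posRoots.1 hi)]
  rw [h1, mul_one] at h
  have h2 : sgn b w * sgn b w = 1 := by
    rw [sgn, ← Finset.prod_mul_distrib]
    exact Finset.prod_eq_one fun _ _ => by split_ifs <;> simp
  have h3 : sgn b (v * w) * sgn b w = sgn b v := by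
    simpa only [sgn, mul_smul] using h
  rw [← h3, mul_assoc, h2, mul_one]

theorem sgn_eq_prod_inversions (w : P.weylGroup) : sgn b w = ∏ _i ∈ inversions b w, (-1) := by
  classical
  have : inversions b w = (posRoots b).filter fun i => ¬ b.IsPos (w • i) := by
    ext i; simp [mem_inversions, mem_posRoots]
  rw [sgn, this, Finset.prod_filter]
  exact Finset.prod_congr rfl fun _ _ => by split_ifs <;> simp_all

theorem inversions_refl {i : ι} (hi : i ∈ b.support) : inversions b (refl P i) = {i} := by
  ext j
  rw [mem_inversions, Finset.mem_singleton]
  constructor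
  · rintro ⟨h1, h2⟩
    exact eq_of_isPos_of_not_isPos_refl b hi h1 h2
  · rintro rfl
    exact ⟨b.isPos_of_mem_support hi, not_isPos_refl_smul_self b hi⟩

theorem sgn_refl {i : ι} (hi : i ∈ b.support) : sgn b (refl P i) = -1 := by
  rw [sgn_eq_prod_inversions, inversions_refl b hi, Finset.prod_singleton]

theorem sgn_one : sgn b (1 : P.weylGroup) = 1 := by
  rw [sgn]
  exact Finset.prod_eq_one fun i hi => by rw [one_smul, if_pos (mem_posRoots.1 hi)]

section RootSystem

variable [P.IsRootSystem]

theorem refl_mem_closure (i : ι) :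
    refl P i ∈ Subgroup.closure (refl P '' b.support) := by
  refine b.induction_reflect i (p := fun i => refl P i ∈ Subgroup.closure (refl P '' b.support)) ?_
    (fun i hi => Subgroup.subset_closure ⟨i, hi, rfl⟩) ?_
  · intro i hi
    rw [← refl_smul_idx, refl_smul_eq_conj]
    exact mul_mem (mul_mem hi hi) (inv_mem hi)
  · intro i j hi hj
    have hj' : refl P j ∈ Subgroup.closure (refl P '' b.support) :=
      Subgroup.subset_closure ⟨j, hj, rfl⟩
    rw [← refl_smul_idx, refl_smul_eq_conj]
    exact mul_mem (mul_mem hj' hi) (inv_mem hj')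

/-- Every element of the Weyl group is a product of simple reflections. -/
theorem exists_word (w : P.weylGroup) :
    ∃ l : List ι, (∀ i ∈ l, i ∈ b.support) ∧ (l.map (refl P)).prod = w := by
  obtain ⟨w, hw⟩ := w
  induction hw using weylGroup.induction with
  | mem i =>
    have h := refl_mem_closure b i
    change ∃ l : List ι, (∀ i ∈ l, i ∈ b.support) ∧ (l.map (refl P)).prod = refl P i
    generalize refl P i = v at h
    induction h using Subgroup.closure_induction'' with
    | one => exact ⟨[], by simp, by simp⟩
    | mem x hx =>
      obtain ⟨j, hj, rfl⟩ := hx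
      exact ⟨[j], by simpa using hj, by simp⟩
    | inv_mem x hx =>
      obtain ⟨j, hj, rfl⟩ := hx
      exact ⟨[j], by simpa using hj, by simp [refl_inv]⟩
    | mul x y _ _ hx hy =>
      obtain ⟨l, hl, rfl⟩ := hx
      obtain ⟨m, hm, rfl⟩ := hy
      refine ⟨l ++ m, fun i hi => ?_, by simp⟩
      rcases List.mem_append.1 hi with h | h
      exacts [hl i h, hm i h]
  | one => exact ⟨[], by simp, rfl⟩
  | mul x y hx hy h1 h2 =>
    obtain ⟨l, hl, h1⟩ := h1
    obtain ⟨m, hm, h2⟩ := h2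
    refine ⟨l ++ m, fun i hi => ?_, ?_⟩
    · rcases List.mem_append.1 hi with h | h
      exacts [hl i h, hm i h]
    · rw [List.map_append, List.prod_append, h1, h2]
      rfl

/-- The exchange condition. -/
theorem exists_shorter_word (l : List ι) (hl : ∀ i ∈ l, i ∈ b.support) {i : ι}
    (hi : i ∈ b.support) (h : ¬ b.IsPos ((l.map (refl P)).prod • i)) :
    ∃ m : List ι, (∀ i ∈ m, i ∈ b.support) ∧ m.length + 1 = l.length ∧
      (m.map (refl P)).prod = (l.map (refl P)).prod * refl P i := by
  induction l with
  | nil =>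
    exact absurd (b.isPos_of_mem_support hi) (by simpa using h)
  | cons j l ih =>
    have hl' : ∀ i ∈ l, i ∈ b.support := fun i hi => hl i (List.mem_cons_of_mem _ hi)
    have hj : j ∈ b.support := hl j List.mem_cons_self
    rw [List.map_cons, List.prod_cons, mul_smul] at h
    by_cases h' : b.IsPos ((l.map (refl P)).prod • i)
    · have e := eq_of_isPos_of_not_isPos_refl b hj h' h
      refine ⟨l, hl', rfl, ?_⟩
      have := refl_smul_eq_conj (l.map (refl P)).prod i
      rw [e] at this
      rw [List.map_cons, List.prod_cons, this, inv_mul_cancel_right, mul_assoc, refl_mul_self,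
        mul_one]
    · obtain ⟨m, hm, hlen, hprod⟩ := ih hl' h'
      refine ⟨j :: m, fun i hi => ?_, by simp [hlen], ?_⟩
      · rcases List.mem_cons.1 hi with rfl | hi
        exacts [hj, hm _ hi]
      · rw [List.map_cons, List.prod_cons, hprod, List.map_cons, List.prod_cons, mul_assoc]

theorem eq_one_of_forall_isPos {w : P.weylGroup} (hw : ∀ i ∈ b.support, b.IsPos (w • i)) :
    w = 1 := by
  obtain ⟨l, hl, rfl⟩ := exists_word b w
  induction hn : l.length using Nat.strong_induction_on generalizing l with
  | _ n ih =>
    rcases List.eq_nil_or_concat l with rfl | ⟨l', i, rfl⟩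
    · simp
    · rw [List.concat_eq_append] at *
      have hi : i ∈ b.support := hl i (by simp)
      have hl' : ∀ j ∈ l', j ∈ b.support := fun j hj => hl j (by simp [hj])
      have e : ((l' ++ [i]).map (refl P)).prod = (l'.map (refl P)).prod * refl P i := by simp
      have h1 := hw i hi
      rw [e, mul_smul, refl_smul_self, smul_negIdx, isPos_negIdx] at h1
      obtain ⟨m, hm, hlen, hprod⟩ := exists_shorter_word b l' hl' hi h1
      rw [e, ← hprod] at hw ⊢
      exact ih m.length (by simp at hn; omega) m hm hw rfl

theorem exists_mem_support_not_isPos {w : P.weylGroup} (hw : w ≠ 1) :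
    ∃ i ∈ b.support, ¬ b.IsPos (w • i) := by
  by_contra! h
  exact hw (eq_one_of_forall_isPos b h)

theorem length_mul_refl_lt {w : P.weylGroup} {i : ι} (hi : i ∈ b.support)
    (hw : ¬ b.IsPos (w • i)) : length b (w * refl P i) < length b w := by
  classical
  have hmaps : ∀ j ∈ inversions b (w * refl P i), refl P i • j ∈ (inversions b w).erase i := by
    intro j hj
    rw [mem_inversions, mul_smul] at hj
    rw [Finset.mem_erase, mem_inversions]
    have hne : j ≠ i := by
      rintro rfl
      apply hj.2
      rw [refl_smul_self, smul_negIdx, isPos_negIdx]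
      exact hw
    refine ⟨fun h => ?_, isPos_refl_smul b hi hj.1 hne, hj.2⟩
    have h2 : j = negIdx P i := by
      rw [← refl_smul_smul (P := P) i j, h, refl_smul_self]
    have := hj.1
    rw [h2, isPos_negIdx] at this
    exact this (b.isPos_of_mem_support hi)
  have h1 := Finset.card_le_card_of_injOn _ hmaps
    ((MulAction.injective (refl P i)).injOn)
  have hi' : i ∈ inversions b w := mem_inversions.2 ⟨b.isPos_of_mem_support hi, hw⟩
  exact h1.trans_lt (Finset.card_erase_lt_of_mem hi')

end RootSystem

end Positive

section Heights

variable [P.IsCrystallographic] [P.IsReduced] (b : P.Base)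

theorem refl_smul_mem_erase [DecidableEq ι] {i j : ι} (hi : i ∈ b.support)
    (hj : j ∈ (posRoots b).erase i) : refl P i • j ∈ (posRoots b).erase i := by
  rw [Finset.mem_erase, mem_posRoots] at *
  refine ⟨fun h => ?_, isPos_refl_smul b hi hj.2 hj.1⟩
  have h2 : j = negIdx P i := by rw [← refl_smul_smul (P := P) i j, h, refl_smul_self]
  have := hj.2
  rw [h2, isPos_negIdx] at this
  exact this (b.isPos_of_mem_support hi)

theorem prod_posRoots_eq_of_refl {A : Type*} [CommMonoid A] {i : ι} (hi : i ∈ b.support)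
    (f : ι → A) (hf : ∀ j, f j * f (refl P i • j) = 1)
    (hfix : ∀ j, refl P i • j = j → f j = 1) : ∏ j ∈ posRoots b, f j = f i := by
  classical
  rw [← Finset.mul_prod_erase _ _ (mem_posRoots.2 (b.isPos_of_mem_support hi)),
    Finset.prod_involution (fun j _ => refl P i • j) (fun j _ => hf j)
      (fun j _ h1 h2 => h1 (hfix j h2)) (fun j hj => refl_smul_mem_erase b hi hj)
      (fun j _ => refl_smul_smul i j), mul_one]

theorem sum_posRoots_eq_of_refl {i : ι} (hi : i ∈ b.support)
    (f : ι → ℝ) (hf : ∀ j, f (refl P i • j) = -f j) : ∑ j ∈ posRoots b, f j = f i := by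
  have := prod_posRoots_eq_of_refl b hi (fun j => Multiplicative.ofAdd (f j))
    (fun j => by rw [hf, ← ofAdd_add, add_neg_cancel, ofAdd_zero])
    (fun j hj => by
      have := hf j
      rw [hj] at this
      have h0 : f j = 0 := by linarith
      rw [h0, ofAdd_zero])
  rw [← ofAdd_sum] at this
  exact Multiplicative.ofAdd.injective this

theorem pairing_refl_smul_left (i j : ι) : P.pairing (refl P i • j) i = -P.pairing j i := by
  have h := pairing_smul (refl P i) j (refl P i • i)
  rw [refl_smul_smul] at h
  rw [h, refl_smul_self, negIdx, P.pairing_reflectionPerm_self_right]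

theorem pairing_refl_smul_right (i j : ι) : P.pairing i (refl P i • j) = -P.pairing i j := by
  have h := pairing_smul (refl P i) (refl P i • i) j
  rw [refl_smul_smul] at h
  rw [h, refl_smul_self, negIdx, P.pairing_reflectionPerm_self_left]

/-- The linear form `⟨2ρ, ·⟩` on the coroot space. -/
noncomputable def coheight : N →ₗ[ℝ] ℝ := ∑ j ∈ posRoots b, P.root' j

/-- The linear form `⟨2ρ^∨, ·⟩` on the root space. -/
noncomputable def rootHeight : M →ₗ[ℝ] ℝ := ∑ j ∈ posRoots b, P.coroot' j

theorem coheight_coroot_simple {i : ι} (hi : i ∈ b.support) : coheight b (P.coroot i) = 2 := by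
  rw [coheight, LinearMap.sum_apply]
  simp only [P.root'_coroot_eq_pairing]
  rw [sum_posRoots_eq_of_refl b hi (fun j => P.pairing j i) (pairing_refl_smul_left i),
    P.pairing_same]

theorem rootHeight_root_simple {i : ι} (hi : i ∈ b.support) : rootHeight b (P.root i) = 2 := by
  rw [rootHeight, LinearMap.sum_apply]
  simp only [P.root_coroot'_eq_pairing]
  rw [sum_posRoots_eq_of_refl b hi (fun j => P.pairing i j) (pairing_refl_smul_right i),
    P.pairing_same]

theorem coroot'_rho_simple {k : ι → ℝ} (hk : IsInvariant P k) {i : ι} (hi : i ∈ b.support) :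
    P.coroot' i (rho b k) = k i := by
  simp only [rho, map_smul, map_sum, P.root_coroot'_eq_pairing, smul_eq_mul]
  rw [sum_posRoots_eq_of_refl b hi (fun j => k j * P.pairing j i) (fun j => by
    rw [hk, pairing_refl_smul_left]; ring), P.pairing_same]
  ring

theorem exists_root_eq_sum_nonneg {i : ι} (hi : b.IsPos i) :
    ∃ c : ι → ℝ, (∀ j, 0 ≤ c j) ∧ P.root i = ∑ j ∈ b.support, c j • P.root j := by
  obtain ⟨f, -, h | h⟩ := b.exists_root_eq_sum_nat_or_neg i
  · exact ⟨fun j => f j, fun j => Nat.cast_nonneg _, by simp only [h, Nat.cast_smul_eq_nsmul]⟩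
  · have h' : P.root i = ∑ j ∈ b.support, (-(f j : ℤ)) • P.root j := by
      simp [h]
    have h2 := b.height_eq_sum h'
    rw [Base.isPos_iff, h2, Finset.sum_neg_distrib] at hi
    have : 0 ≤ ∑ j ∈ b.support, (f j : ℤ) := Finset.sum_nonneg fun _ _ => by positivity
    omega

theorem exists_coroot_eq_sum_nonneg {i : ι} (hi : b.IsPos i) :
    ∃ c : ι → ℝ, (∀ j, 0 ≤ c j) ∧ P.coroot i = ∑ j ∈ b.support, c j • P.coroot j := by
  obtain ⟨c, hc, h⟩ := exists_root_eq_sum_nonneg b hi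
  have hpos : ∀ j, 0 < P.RootForm (P.root j) (P.root j) := fun j =>
    P.rootForm_pos_of_ne_zero (Submodule.subset_span ⟨j, rfl⟩) (P.ne_zero j)
  refine ⟨fun j => (P.RootForm (P.root i) (P.root i))⁻¹ *
    (c j * P.RootForm (P.root j) (P.root j)), fun j => ?_, ?_⟩
  · have := hpos i
    have := hpos j
    have := hc j
    positivity
  · have hi' := P.rootForm_self_smul_coroot i
    have hr := (hpos i).ne'
    generalize P.RootForm (P.root i) (P.root i) = r at hi' hr ⊢
    rw [← inv_smul_smul₀ hr (P.coroot i), hi', h, map_sum, Finset.smul_sum, Finset.smul_sum]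
    refine Finset.sum_congr rfl fun j _ => ?_
    rw [mul_smul, mul_smul, P.rootForm_self_smul_coroot, map_smul, smul_comm (2 : ℕ)]

theorem linearForm_pos_of_simple {V : Type*} [AddCommGroup V] [Module ℝ V] (v : ι → V)
    (φ : V →ₗ[ℝ] ℝ) (hφ : ∀ j ∈ b.support, 0 < φ (v j)) {x : V} (hx : x ≠ 0) {c : ι → ℝ}
    (hc : ∀ j, 0 ≤ c j) (h : x = ∑ j ∈ b.support, c j • v j) : 0 < φ x := by
  rw [h, map_sum]
  simp only [map_smul, smul_eq_mul]
  refine Finset.sum_pos' (fun j hj => mul_nonneg (hc j) (hφ j hj).le) ?_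
  by_contra! h0
  apply hx
  rw [h]
  refine Finset.sum_eq_zero fun j hj => ?_
  have h1 := hφ j hj
  have h2 : c j = 0 := by
    by_contra hne
    have := mul_pos (lt_of_le_of_ne (hc j) (Ne.symm hne)) h1
    linarith [h0 j hj]
  rw [h2, zero_smul]

theorem coheight_coroot_pos {i : ι} (hi : b.IsPos i) : 0 < coheight b (P.coroot i) := by
  obtain ⟨c, hc, h⟩ := exists_coroot_eq_sum_nonneg b hi
  exact linearForm_pos_of_simple b _ _
    (fun j hj => by rw [coheight_coroot_simple b hj]; norm_num) (P.flip.ne_zero i) hc h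

theorem rootHeight_root_pos {i : ι} (hi : b.IsPos i) : 0 < rootHeight b (P.root i) := by
  obtain ⟨c, hc, h⟩ := exists_root_eq_sum_nonneg b hi
  exact linearForm_pos_of_simple b _ _
    (fun j hj => by rw [rootHeight_root_simple b hj]; norm_num) (P.ne_zero i) hc h

theorem coroot'_eq_sum {i : ι} {c : ι → ℝ} (h : P.coroot i = ∑ j ∈ b.support, c j • P.coroot j)
    (x : M) : P.coroot' i x = ∑ j ∈ b.support, c j * P.coroot' j x := by
  change P.toLinearMap x (P.coroot i) = _
  rw [h, map_sum]
  exact Finset.sum_congr rfl fun j _ => by rw [map_smul]; rfl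

theorem coroot'_nonneg {i : ι} (hi : b.IsPos i) {x : M}
    (hx : ∀ j ∈ b.support, 0 ≤ P.coroot' j x) : 0 ≤ P.coroot' i x := by
  obtain ⟨c, hc, h⟩ := exists_coroot_eq_sum_nonneg b hi
  rw [coroot'_eq_sum b h]
  exact Finset.sum_nonneg fun j hj => mul_nonneg (hc j) (hx j hj)

theorem IsDominantWeight.coroot'_nonneg {μ : M} (hμ : IsDominantWeight b μ) {i : ι}
    (hi : b.IsPos i) : 0 ≤ P.coroot' i μ :=
  HeckmanOpdam.coroot'_nonneg b hi fun j hj => by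
    obtain ⟨n, hn⟩ := hμ j hj
    rw [hn]
    positivity

theorem coroot'_rho_nonneg {k : ι → ℝ} (hk : IsInvariant P k) (h0 : ∀ i, 0 ≤ k i) {i : ι}
    (hi : b.IsPos i) : 0 ≤ P.coroot' i (rho b k) :=
  coroot'_nonneg b hi fun j hj => by rw [coroot'_rho_simple b hk hj]; exact h0 j

end Heights

section Macdonald

variable [P.IsCrystallographic] [P.IsReduced] (b : P.Base)

theorem sum_posRoots_smul_of_odd {V : Type*} [AddCommGroup V] (w : P.weylGroup) (f : ι → V)
    (hf : ∀ i, f (negIdx P i) = -f i) :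
    ∑ i ∈ posRoots b, f (w • i) =
      ∑ i ∈ posRoots b, f i - (2 : ℕ) • ∑ i ∈ inversions b w⁻¹, f i := by
  classical
  have h := sum_posRoots_smul b w (fun j => if b.IsPos (w⁻¹ • j) then f j else -f j) (fun i => by
    rw [smul_negIdx, isPos_negIdx, hf]
    split_ifs <;> simp_all)
  have h1 : ∑ i ∈ posRoots b, f (w • i) =
      ∑ i ∈ posRoots b, if b.IsPos (w⁻¹ • w • i) then f (w • i) else -f (w • i) :=
    Finset.sum_congr rfl fun i hi => by rw [inv_smul_smul, if_pos (mem_posRoots.1 hi)]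
  have h2 : inversions b w⁻¹ = (posRoots b).filter fun i => ¬ b.IsPos (w⁻¹ • i) := by
    ext i; simp [mem_inversions, mem_posRoots]
  rw [h1, h, h2, Finset.smul_sum, Finset.sum_filter, ← Finset.sum_sub_distrib]
  refine Finset.sum_congr rfl fun i _ => ?_
  split_ifs
  · rw [sub_zero]
  · rw [two_smul]; abel

/-- Half the sum of the positive coroots. -/
noncomputable def corho : N := (1 / 2 : ℝ) • ∑ i ∈ posRoots b, P.coroot i

theorem root'_corho_simple {i : ι} (hi : i ∈ b.support) : P.root' i (corho b) = 1 := by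
  simp only [corho, map_smul, map_sum, P.root'_coroot_eq_pairing, smul_eq_mul]
  rw [sum_posRoots_eq_of_refl b hi (fun j => P.pairing i j) (pairing_refl_smul_right i),
    P.pairing_same]
  norm_num

theorem coact_corho (w : P.weylGroup) :
    coact w (corho b) = corho b - ∑ i ∈ inversions b w⁻¹, P.coroot i := by
  simp only [corho, map_smul, map_sum, coact_coroot]
  rw [sum_posRoots_smul_of_odd b w (fun i => P.coroot i) coroot_negIdx, smul_sub,
    ← Nat.cast_smul_eq_nsmul ℝ, smul_smul]
  norm_num

theorem weyl_smul_rho {k : ι → ℝ} (hk : IsInvariant P k) (w : P.weylGroup) :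
    w • rho b k = rho b k - ∑ i ∈ inversions b w⁻¹, k i • P.root i := by
  simp only [rho]
  rw [weylGroup_smul_smul, weylGroup_smul_sum]
  have h : ∀ i ∈ posRoots b, w • k i • P.root i = k (w • i) • P.root (w • i) := fun i _ => by
    rw [weylGroup_smul_smul, root_smul, hk]
  rw [Finset.sum_congr rfl h, sum_posRoots_smul_of_odd b w (fun i => k i • P.root i) fun i => by
    rw [root_negIdx, smul_neg, ← refl_smul_self, hk], smul_sub,
    ← Nat.cast_smul_eq_nsmul ℝ, smul_smul]
  norm_num

theorem le_coroot'_rho {k : ι → ℝ} (hk : IsInvariant P k) (h0 : ∀ i, 0 ≤ k i) {i : ι}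
    (hi : b.IsPos i) : k i ≤ P.coroot' i (rho b k) := by
  have h := weyl_smul_rho b hk (refl P i)
  rw [refl_smul, refl_inv, sub_right_inj] at h
  have h1 := congrArg (rootHeight b) h
  simp only [map_smul, map_sum, smul_eq_mul] at h1
  have h2 : k i * rootHeight b (P.root i) ≤
      ∑ j ∈ inversions b (refl P i), k j * rootHeight b (P.root j) := by
    refine Finset.single_le_sum (f := fun j => k j * rootHeight b (P.root j)) (fun j hj => ?_) ?_
    · exact mul_nonneg (h0 j) (rootHeight_root_pos b (mem_inversions.1 hj).1).le
    · rw [mem_inversions, refl_smul_self, isPos_negIdx, not_not]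
      exact ⟨hi, hi⟩
  rw [← h1] at h2
  exact le_of_mul_le_mul_right h2 (rootHeight_root_pos b hi)

/-- The coroot lattice. -/
def corootLattice (P : RootPairing ι ℝ M N) : AddSubgroup N :=
  AddSubgroup.closure (Set.range P.coroot)

theorem coroot_mem_corootLattice (i : ι) : P.coroot i ∈ corootLattice P :=
  AddSubgroup.subset_closure ⟨i, rfl⟩

theorem sum_coroot_mem_corootLattice {κ : Type*} (s : Finset κ) (f : κ → ι) :
    ∑ i ∈ s, P.coroot (f i) ∈ corootLattice P :=
  sum_mem fun i _ => coroot_mem_corootLattice (f i)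

theorem exists_root'_eq_intCast {y : N} (hy : y ∈ corootLattice P) (i : ι) :
    ∃ n : ℤ, P.root' i y = n := by
  induction hy using AddSubgroup.closure_induction with
  | mem x hx =>
    obtain ⟨j, rfl⟩ := hx
    refine ⟨P.pairingIn ℤ i j, ?_⟩
    rw [P.root'_coroot_eq_pairing, ← P.algebraMap_pairingIn ℤ]
    rfl
  | zero => exact ⟨0, by simp⟩
  | add x y _ _ hx hy =>
    obtain ⟨m, hm⟩ := hx
    obtain ⟨n, hn⟩ := hy
    exact ⟨m + n, by simp [hm, hn]⟩
  | neg x _ hx =>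
    obtain ⟨m, hm⟩ := hx
    exact ⟨-m, by simp [hm]⟩

theorem corootForm_coroot (i : ι) (z : N) :
    2 * P.CorootForm (P.coroot i) z = P.CorootForm (P.coroot i) (P.coroot i) * P.root' i z := by
  have h := congrArg (fun x => P.toLinearMap x z) (P.corootForm_self_smul_root i)
  simp only [map_smul, map_nsmul, LinearMap.smul_apply,
    P.toLinearMap_apply_CoPolarization] at h
  rw [smul_eq_mul, nsmul_eq_mul] at h
  exact_mod_cast h.symm

variable [P.IsRootSystem]

theorem corootForm_pos {z : N} (hz : z ≠ 0) : 0 < P.CorootForm z z :=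
  P.flip.rootForm_pos_of_ne_zero (by simp) hz

theorem root'_nonpos {z : N} (hz : ∀ j ∈ b.support, P.root' j z ≤ 0) {i : ι} (hi : b.IsPos i) :
    P.root' i z ≤ 0 := by
  obtain ⟨c, hc, h⟩ := exists_root_eq_sum_nonneg b hi
  change P.toLinearMap (P.root i) z ≤ 0
  rw [h, map_sum, LinearMap.sum_apply]
  refine Finset.sum_nonpos fun j hj => ?_
  rw [map_smul]
  exact mul_nonpos_of_nonneg_of_nonpos (hc j) (hz j hj)

/-- A sum of positive coroots that pairs nonpositively with the simple roots vanishes. -/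
theorem eq_zero_of_root'_nonpos {κ : Type*} (s : Finset κ) (a : κ → N)
    (ha : ∀ i ∈ s, a i = 0 ∨ ∃ j, b.IsPos j ∧ a i = P.coroot j)
    (hz : ∀ j ∈ b.support, P.root' j (∑ i ∈ s, a i) ≤ 0) : ∀ i ∈ s, a i = 0 := by
  set z := ∑ i ∈ s, a i with hzdef
  have hz0 : z = 0 := by
    by_contra hne
    have h1 := corootForm_pos (P := P) hne
    have h2 : P.CorootForm z z = ∑ i ∈ s, P.CorootForm (a i) z := by
      rw [← LinearMap.sum_apply, ← map_sum, ← hzdef]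
    have h3 : ∑ i ∈ s, P.CorootForm (a i) z ≤ 0 := by
      refine Finset.sum_nonpos fun i hi => ?_
      rcases ha i hi with h | ⟨j, hj, h⟩
      · rw [h, map_zero, LinearMap.zero_apply]
      · have h4 := corootForm_coroot (P := P) j z
        have h5 := corootForm_pos (P := P) (P.flip.ne_zero j)
        have h6 := root'_nonpos b hz hj
        have h7 := mul_nonpos_of_nonneg_of_nonpos h5.le h6
        rw [h]
        change P.CorootForm (P.coroot j) (P.coroot j) * P.root' j z ≤ 0 at h7
        linarith
    linarith
  have h1 : ∑ i ∈ s, coheight b (a i) = 0 := by rw [← map_sum, ← hzdef, hz0, map_zero]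
  have h2 : ∀ i ∈ s, 0 ≤ coheight b (a i) := fun i hi => by
    rcases ha i hi with h | ⟨j, hj, h⟩
    · rw [h, map_zero]
    · rw [h]; exact (coheight_coroot_pos b hj).le
  intro i hi
  rcases ha i hi with h | ⟨j, hj, h⟩
  · exact h
  · have := (Finset.sum_eq_zero_iff_of_nonneg h2).1 h1 i hi
    rw [h] at this
    exact absurd this (coheight_coroot_pos b hj).ne'

theorem exists_coact_dominant (y : N) :
    ∃ v : P.weylGroup, ∀ j ∈ b.support, 0 ≤ P.root' j (coact v⁻¹ y) := by
  obtain ⟨v, hv⟩ := Finite.exists_max fun v : P.weylGroup => coheight b (coact v⁻¹ y)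
  refine ⟨v, fun j hj => ?_⟩
  have h := hv (v * refl P j)
  rw [mul_inv_rev, refl_inv, coact_mul, coact_refl, map_sub, map_smul, coheight_coroot_simple b hj,
    smul_eq_mul] at h
  linarith

theorem corho_sub_sum_eq (E : Finset ι) (v : P.weylGroup) [DecidablePred (· ∈ E)]
    [∀ i, Decidable (b.IsPos (v • i))] (hE : E ⊆ posRoots b) :
    corho b - coact v (corho b - ∑ i ∈ E, P.coroot i) = ∑ i ∈ posRoots b,
      if i ∈ E then if b.IsPos (v • i) then P.coroot (v • i) else 0
      else if b.IsPos (v • i) then 0 else -P.coroot (v • i) := by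
  classical
  have h := sum_posRoots_smul b v (fun j => if b.IsPos j then P.coroot j else -P.coroot j)
    (fun i => by
      rw [isPos_negIdx, coroot_negIdx]
      split_ifs <;> simp_all)
  have h1 : ∑ i ∈ posRoots b, (if b.IsPos i then P.coroot i else -P.coroot i) =
      ∑ i ∈ posRoots b, P.coroot i :=
    Finset.sum_congr rfl fun i hi => by rw [if_pos (mem_posRoots.1 hi)]
  have h2 : ∑ i ∈ E, P.coroot (v • i) =
      ∑ i ∈ posRoots b, if i ∈ E then P.coroot (v • i) else 0 := by
    rw [← Finset.sum_filter, Finset.filter_mem_eq_inter, Finset.inter_eq_right.2 hE]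
  rw [map_sub, map_sum]
  simp only [coact_coroot]
  rw [h2]
  simp only [corho, map_smul, map_sum, coact_coroot]
  rw [← h1, ← h, sub_sub_eq_add_sub, Finset.smul_sum, Finset.smul_sum, ← Finset.sum_add_distrib,
    ← Finset.sum_sub_distrib]
  refine Finset.sum_congr rfl fun i _ => ?_
  split_ifs <;> module

/-- `ρ^∨ - ∑ E` is, up to the Weyl group, either singular or equal to `ρ^∨`. -/
theorem exists_singular_or_eq_inversions (E : Finset ι) (hE : E ⊆ posRoots b) :
    ∃ v : P.weylGroup, (∃ j ∈ b.support,
      P.root' j (coact v⁻¹ (corho b - ∑ i ∈ E, P.coroot i)) = 0) ∨ E = inversions b v⁻¹ := by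
  classical
  obtain ⟨v, hv⟩ := exists_coact_dominant b (corho b - ∑ i ∈ E, P.coroot i)
  refine ⟨v, or_iff_not_imp_left.2 fun h => ?_⟩
  push Not at h
  have key := corho_sub_sum_eq b E v⁻¹ hE
  have hz : ∀ j ∈ b.support,
      P.root' j (corho b - coact v⁻¹ (corho b - ∑ i ∈ E, P.coroot i)) ≤ 0 := by
    intro j hj
    have hpos := lt_of_le_of_ne (hv j hj) (Ne.symm (h j hj))
    have hmem : corho b - coact v⁻¹ (corho b - ∑ i ∈ E, P.coroot i) ∈ corootLattice P := by
      rw [key]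
      refine sum_mem fun i _ => ?_
      split_ifs
      exacts [coroot_mem_corootLattice _, zero_mem _, zero_mem _,
        neg_mem (coroot_mem_corootLattice _)]
    obtain ⟨n, hn⟩ := exists_root'_eq_intCast hmem j
    have h1 : (n : ℝ) < 1 := by
      rw [← hn, map_sub, root'_corho_simple b hj]
      linarith
    have h2 : n < 1 := by exact_mod_cast h1
    rw [hn]
    exact_mod_cast Int.lt_add_one_iff.1 (by simpa using h2)
  rw [key] at hz
  have hall := eq_zero_of_root'_nonpos b _ _ (fun i _ => by
    split_ifs with h1 h2 h2
    · exact Or.inr ⟨_, h2, rfl⟩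
    · exact Or.inl rfl
    · exact Or.inl rfl
    · exact Or.inr ⟨_, (isPos_negIdx b _).2 h2, (coroot_negIdx _).symm⟩) hz
  have hne : ∀ i, P.coroot i ≠ 0 := fun i => P.flip.ne_zero i
  ext i
  rw [mem_inversions]
  constructor
  · intro hi
    refine ⟨mem_posRoots.1 (hE hi), fun hp => ?_⟩
    have := hall i (hE hi)
    rw [if_pos hi, if_pos hp] at this
    exact hne _ this
  · rintro ⟨hi, hp⟩
    by_contra hn
    have := hall i (mem_posRoots.2 hi)
    rw [if_neg hn, if_neg hp] at this
    exact hne _ (neg_eq_zero.1 this)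

theorem inversions_inv_injective :
    Function.Injective fun w : P.weylGroup => inversions b w⁻¹ := by
  intro v w hvw
  have h : coact v (corho b) = coact w (corho b) := by
    rw [coact_corho, coact_corho]
    exact congrArg (fun s => corho b - ∑ i ∈ s, P.coroot i) hvw
  have h1 : coact (w⁻¹ * v) (corho b) = corho b := by
    rw [coact_mul, h, coact_inv_coact]
  rw [coact_corho, sub_eq_self] at h1
  have h2 := congrArg (coheight b) h1
  rw [map_sum, map_zero, Finset.sum_eq_zero_iff_of_nonneg fun i hi =>
    (coheight_coroot_pos b (mem_inversions.1 hi).1).le] at h2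
  have h3 : (w⁻¹ * v)⁻¹ = 1 := by
    refine eq_one_of_forall_isPos b fun i hi => ?_
    by_contra hn
    have hp := b.isPos_of_mem_support hi
    exact (coheight_coroot_pos b hp).ne' (h2 i (mem_inversions.2 ⟨hp, hn⟩))
  rw [inv_eq_one, inv_mul_eq_one] at h3
  exact h3.symm

end Macdonald

section Exponential

variable [P.IsCrystallographic] [P.IsReduced] (b : P.Base)
  {K : Type*} [Field K]

/-- A function on the coroot space that is a character on the coroot lattice. -/
structure IsExponential (P : RootPairing ι ℝ M N) (e : N → K) : Prop where
  zero : e 0 = 1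
  add : ∀ x ∈ corootLattice P, ∀ y ∈ corootLattice P, e (x + y) = e x * e y

theorem IsExponential.sum {e : N → K} (he : IsExponential P e) {κ : Type*} (s : Finset κ)
    (f : κ → ι) : e (∑ i ∈ s, P.coroot (f i)) = ∏ i ∈ s, e (P.coroot (f i)) := by
  classical
  induction s using Finset.induction_on with
  | empty => simp [he.zero]
  | insert i s hi ih =>
    rw [Finset.sum_insert hi, Finset.prod_insert hi, he.add _ (coroot_mem_corootLattice _) _
      (sum_coroot_mem_corootLattice _ _), ih]

theorem IsExponential.coroot_negIdx {e : N → K} (he : IsExponential P e) (i : ι) :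
    e (P.coroot i) * e (P.coroot (negIdx P i)) = 1 := by
  rw [← he.add _ (coroot_mem_corootLattice _) _ (coroot_mem_corootLattice _),
    HeckmanOpdam.coroot_negIdx, add_neg_cancel, he.zero]

theorem IsInvariant.negIdx {A : Type*} {t : ι → A} (ht : IsInvariant P t) (i : ι) :
    t (negIdx P i) = t i := ht (refl P i) i

variable [P.IsRootSystem]

/-- The alternating sum `∑_w sgn(w) e(ρ^∨ - w y)`. -/
noncomputable def altSum (e : N → K) (y : N) : K :=
  ∑ w : P.weylGroup, (sgn b w : K) * e (corho b - coact w y)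

theorem sgn_mul_self (w : P.weylGroup) : sgn b w * sgn b w = 1 := by
  rw [sgn_eq_prod_inversions, ← Finset.prod_mul_distrib]
  exact Finset.prod_eq_one fun _ _ => by norm_num

theorem sgn_inv (w : P.weylGroup) : sgn b w⁻¹ = sgn b w := by
  have h := sgn_mul b w⁻¹ w
  rw [inv_mul_cancel, sgn_one] at h
  calc sgn b w⁻¹ = sgn b w⁻¹ * (sgn b w * sgn b w) := by rw [sgn_mul_self, mul_one]
    _ = sgn b w := by rw [← mul_assoc, ← h, one_mul]

theorem altSum_coact (e : N → K) (v : P.weylGroup) (y : N) :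
    altSum b e (coact v y) = (sgn b v : K) * altSum b e y := by
  have h : altSum b e (coact v y) =
      ∑ w : P.weylGroup, (sgn b v : K) * ((sgn b (w * v) : K) * e (corho b - coact (w * v) y)) := by
    refine Finset.sum_congr rfl fun w _ => ?_
    have h1 : (sgn b v : K) * sgn b v = 1 := by
      exact_mod_cast congrArg (Int.cast (R := K)) (sgn_mul_self b v)
    rw [sgn_mul, coact_mul, Int.cast_mul]
    linear_combination -(sgn b w : K) * e (corho b - coact w (coact v y)) * h1
  rw [h, ← Finset.mul_sum]
  congr 1
  exact Fintype.sum_equiv (Equiv.mulRight v) _ _ fun w => rfl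

theorem altSum_eq_zero [CharZero K] (e : N → K) {y : N} {i : ι} (hi : i ∈ b.support)
    (hy : P.root' i y = 0) : altSum b e y = 0 := by
  have h := altSum_coact b e (refl P i) y
  rw [coact_refl, hy, zero_smul, sub_zero, sgn_refl b hi] at h
  push_cast at h
  rw [neg_one_mul] at h
  exact self_eq_neg.mp h

theorem sum_powerset_altSum [CharZero K] (e : N → K) (t : ι → K) :
    ∑ E ∈ (posRoots b).powerset, (∏ i ∈ E, -t i) * altSum b e (corho b - ∑ i ∈ E, P.coroot i) =
      poincare b t * altSum b e (corho b) := by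
  classical
  have himg : Finset.univ.image (fun w : P.weylGroup => inversions b w⁻¹) ⊆
      (posRoots b).powerset := by
    intro E hE
    obtain ⟨w, -, rfl⟩ := Finset.mem_image.1 hE
    rw [Finset.mem_powerset]
    exact fun i hi => mem_posRoots.2 (mem_inversions.1 hi).1
  rw [← Finset.sum_subset himg, Finset.sum_image (inversions_inv_injective b).injOn, poincare,
    Finset.sum_mul, ← Equiv.sum_comp (Equiv.inv P.weylGroup)]
  · refine Finset.sum_congr rfl fun w _ => ?_
    rw [Equiv.inv_apply, inv_inv]
    have h := coact_corho b w⁻¹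
    rw [inv_inv] at h
    rw [← h, altSum_coact, sgn_inv, sgn_eq_prod_inversions, ← mul_assoc]
    congr 1
    push_cast
    rw [← Finset.prod_mul_distrib]
    exact Finset.prod_congr rfl fun i _ => by ring
  · intro E hE hn
    rw [Finset.mem_powerset] at hE
    obtain ⟨v, ⟨j, hj, hv⟩ | hv⟩ := exists_singular_or_eq_inversions b E hE
    · rw [← coact_coact_inv v (corho b - ∑ i ∈ E, P.coroot i), altSum_coact,
        altSum_eq_zero b e hj hv, mul_zero, mul_zero]
    · exact absurd (Finset.mem_image.2 ⟨v, Finset.mem_univ _, hv.symm⟩) hn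

theorem sum_sgn_mul_prod_eq (e : N → K) (he : IsExponential P e) (t : ι → K) :
    ∑ w : P.weylGroup, (sgn b w : K) * e (corho b - coact w (corho b)) *
        ∏ i ∈ posRoots b, (1 - t i * e (P.coroot (w • i))) =
      ∑ E ∈ (posRoots b).powerset,
        (∏ i ∈ E, -t i) * altSum b e (corho b - ∑ i ∈ E, P.coroot i) := by
  simp only [altSum, Finset.mul_sum]
  rw [Finset.sum_comm]
  refine Finset.sum_congr rfl fun w _ => ?_
  have h : ∀ i ∈ posRoots b, 1 - t i * e (P.coroot (w • i)) = 1 + -t i * e (P.coroot (w • i)) :=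
    fun i _ => by ring
  rw [Finset.prod_congr rfl h, Finset.prod_one_add, Finset.mul_sum]
  refine Finset.sum_congr rfl fun E _ => ?_
  have h2 : corho b - coact w (corho b - ∑ i ∈ E, P.coroot i) =
      (corho b - coact w (corho b)) + ∑ i ∈ E, P.coroot (w • i) := by
    rw [map_sub, map_sum]
    simp only [coact_coroot]
    abel
  have h3 : corho b - coact w (corho b) ∈ corootLattice P := by
    rw [coact_corho, sub_sub_cancel]
    exact sum_coroot_mem_corootLattice _ _
  rw [h2, he.add _ h3 _ (sum_coroot_mem_corootLattice _ _), he.sum, Finset.prod_mul_distrib]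
  ring

open scoped Classical in
theorem sgn_mul_prod_eq (e : N → K) (he : IsExponential P e) (t : ι → K) (ht : IsInvariant P t)
    (w : P.weylGroup) :
    (sgn b w : K) * e (corho b - coact w (corho b)) *
        ∏ i ∈ posRoots b, (1 - t i * e (P.coroot (w • i))) =
      ∏ j ∈ posRoots b, if b.IsPos (w⁻¹ • j) then 1 - t j * e (P.coroot j)
        else t j - e (P.coroot j) := by
  have h1 : (sgn b w : K) * e (corho b - coact w (corho b)) =
      ∏ j ∈ posRoots b, if b.IsPos (w⁻¹ • j) then 1 else -e (P.coroot j) := by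
    rw [coact_corho, sub_sub_cancel, he.sum, ← sgn_inv, sgn_eq_prod_inversions]
    push_cast
    have h2 : inversions b w⁻¹ = (posRoots b).filter fun i => ¬ b.IsPos (w⁻¹ • i) := by
      ext i; simp [mem_inversions, mem_posRoots]
    rw [← Finset.prod_mul_distrib, h2, Finset.prod_filter]
    refine Finset.prod_congr rfl fun i _ => ?_
    split_ifs <;> simp_all
  have h2 := prod_posRoots_smul b w
    (fun j => if b.IsPos (w⁻¹ • j) then 1 - t j * e (P.coroot j)
      else 1 - t j * e (P.coroot (negIdx P j))) (fun i => by
    rw [smul_negIdx, isPos_negIdx, negIdx_negIdx, ht.negIdx]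
    split_ifs <;> simp_all)
  have h3 : ∏ i ∈ posRoots b, (1 - t i * e (P.coroot (w • i))) = ∏ i ∈ posRoots b,
      if b.IsPos (w⁻¹ • w • i) then 1 - t (w • i) * e (P.coroot (w • i))
        else 1 - t (w • i) * e (P.coroot (negIdx P (w • i))) :=
    Finset.prod_congr rfl fun i hi => by
      rw [inv_smul_smul, if_pos (mem_posRoots.1 hi), ht]
  rw [h1, h3, h2, ← Finset.prod_mul_distrib]
  refine Finset.prod_congr rfl fun i _ => ?_
  split_ifs
  · rw [one_mul]
  · have := he.coroot_negIdx i
    linear_combination t i * this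

open scoped Classical in
/-- Macdonald's identity for the Poincaré polynomial, with denominators cleared. -/
theorem macdonald_identity [CharZero K] (e : N → K) (he : IsExponential P e) (t : ι → K)
    (ht : IsInvariant P t) :
    ∑ w : P.weylGroup, ∏ j ∈ posRoots b, (if b.IsPos (w • j) then 1 - t j * e (P.coroot j)
        else t j - e (P.coroot j)) =
      poincare b t * ∏ j ∈ posRoots b, (1 - e (P.coroot j)) := by
  have key : ∀ s : ι → K, IsInvariant P s →
      ∑ w : P.weylGroup, ∏ j ∈ posRoots b, (if b.IsPos (w • j) then 1 - s j * e (P.coroot j)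
        else s j - e (P.coroot j)) = poincare b s * altSum b e (corho b) := by
    intro s hs
    rw [← sum_powerset_altSum, ← sum_sgn_mul_prod_eq b e he,
      ← Equiv.sum_comp (Equiv.inv P.weylGroup)]
    exact Finset.sum_congr rfl fun w _ => (sgn_mul_prod_eq b e he s hs w).symm
  have h1 := key (fun _ => 1) (fun _ _ => rfl)
  simp only [one_mul, ite_self, Finset.sum_const, poincare, Finset.prod_const_one, nsmul_eq_mul,
    mul_one] at h1
  have hcard : ((Finset.univ : Finset P.weylGroup).card : K) ≠ 0 := by
    rw [Nat.cast_ne_zero]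
    exact Finset.card_ne_zero.2 ⟨1, Finset.mem_univ _⟩
  rw [key t ht, ← mul_left_cancel₀ hcard h1]

/-- The identity after division by `∏ (1 - t_α e^{α^∨})`. -/
theorem sum_prod_inversions_eq [CharZero K] (e : N → K) (he : IsExponential P e) (t : ι → K)
    (ht : IsInvariant P t) (hne : ∀ j ∈ posRoots b, 1 - t j * e (P.coroot j) ≠ 0) :
    ∑ w : P.weylGroup, ∏ j ∈ inversions b w,
        (t j - e (P.coroot j)) / (1 - t j * e (P.coroot j)) =
      poincare b t * ∏ j ∈ posRoots b, (1 - e (P.coroot j)) / (1 - t j * e (P.coroot j)) := by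
  classical
  rw [Finset.prod_div_distrib, ← mul_div_assoc, ← macdonald_identity b e he t ht, Finset.sum_div]
  refine Finset.sum_congr rfl fun w _ => ?_
  have h2 : inversions b w = (posRoots b).filter fun i => ¬ b.IsPos (w • i) := by
    ext i; simp [mem_inversions, mem_posRoots]
  rw [← Finset.prod_div_distrib, h2, Finset.prod_filter]
  refine Finset.prod_congr rfl fun i hi => ?_
  by_cases h : b.IsPos (w • i)
  · rw [if_pos h, if_neg (not_not.2 h), div_self (hne i hi)]
  · rw [if_neg h, if_pos h]

end Exponential

section Orbit

variable [P.IsCrystallographic] [P.IsReduced] (b : P.Base) [P.IsRootSystem]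

theorem coroot'_simple_nonneg {μ : M} (hμ : IsDominantWeight b μ) {i : ι} (hi : i ∈ b.support) :
    0 ≤ P.coroot' i μ :=
  hμ.coroot'_nonneg b (b.isPos_of_mem_support hi)

theorem coroot'_nonpos_of_not_isPos {μ : M} (hμ : IsDominantWeight b μ) {i : ι}
    (hi : ¬ b.IsPos i) : P.coroot' i μ ≤ 0 := by
  have h := hμ.coroot'_nonneg b ((isPos_negIdx b i).2 hi)
  change 0 ≤ P.toLinearMap μ (P.coroot (negIdx P i)) at h
  rw [coroot_negIdx, map_neg] at h
  exact neg_nonneg.1 h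

/-- Two dominant weights in the same orbit agree. -/
theorem dominant_smul_eq {μ : M} (hμ : IsDominantWeight b μ) (v : P.weylGroup)
    (hv : IsDominantWeight b (v • μ)) : v • μ = μ := by
  induction hn : length b v using Nat.strong_induction_on generalizing v with
  | _ n ih =>
    by_cases h1 : v = 1
    · rw [h1, one_smul]
    · obtain ⟨i, hi, hvi⟩ := exists_mem_support_not_isPos b h1
      have h2 := coroot'_nonpos_of_not_isPos b hv hvi
      rw [coroot'_smul] at h2
      have h3 : refl P i • μ = μ := by
        rw [refl_smul, le_antisymm h2 (coroot'_simple_nonneg b hμ hi), zero_smul, sub_zero]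
      have h4 : (v * refl P i) • μ = v • μ := by rw [mul_smul, h3]
      rw [← h4]
      refine ih _ ?_ (v * refl P i) (by rwa [h4]) rfl
      rw [← hn]
      exact length_mul_refl_lt b hi hvi

/-- The shortest element sends simple roots orthogonal to `μ` to positive roots. -/
theorem IsShortest.isPos_smul {μ ν : M} {w : P.weylGroup} (hw : IsShortest b ν w)
    (hwμ : w • μ = ν) {i : ι} (hi : i ∈ b.support) (hiμ : P.coroot' i μ = 0) :
    b.IsPos (w • i) := by
  by_contra hn
  have h1 : (w * refl P i)⁻¹ • ν = w⁻¹ • ν := by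
    rw [mul_inv_rev, mul_smul, ← hwμ, inv_smul_smul, refl_inv, refl_smul, hiμ, zero_smul, sub_zero]
  have h2 := hw.2 (w * refl P i) (by rw [h1]; exact hw.1)
  exact absurd (length_mul_refl_lt b hi hn) (not_lt.2 h2)

theorem isPos_smul_of_coroot'_eq_zero {μ : M} (hμ : IsDominantWeight b μ) {w : P.weylGroup}
    (hw : ∀ i ∈ b.support, P.coroot' i μ = 0 → b.IsPos (w • i)) {i : ι} (hi : b.IsPos i)
    (hiμ : P.coroot' i μ = 0) : b.IsPos (w • i) := by
  obtain ⟨c, hc, h⟩ := exists_coroot_eq_sum_nonneg b hi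
  rw [coroot'_eq_sum b h, Finset.sum_eq_zero_iff_of_nonneg fun j hj =>
    mul_nonneg (hc j) (coroot'_simple_nonneg b hμ hj)] at hiμ
  have h1 : 0 ≤ coheight b (P.coroot (w • i)) := by
    rw [← coact_coroot, h, map_sum, map_sum]
    refine Finset.sum_nonneg fun j hj => ?_
    rw [map_smul, map_smul, coact_coroot]
    rcases mul_eq_zero.1 (hiμ j hj) with h0 | h0
    · rw [h0, zero_smul]
    · exact mul_nonneg (hc j) (coheight_coroot_pos b (hw j hj h0)).le
  by_contra hn
  have h2 := coheight_coroot_pos b ((isPos_negIdx b _).2 hn)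
  rw [coroot_negIdx, map_neg] at h2
  linarith

/-- In a coset of the stabilizer of a dominant weight there is at most one element that sends the
simple roots of the stabilizer to positive roots. -/
theorem eq_of_smul_eq {μ : M} (hμ : IsDominantWeight b μ) {v w : P.weylGroup}
    (hvw : v • μ = w • μ) (hv : ∀ i ∈ b.support, P.coroot' i μ = 0 → b.IsPos (v • i))
    (hw : ∀ i ∈ b.support, P.coroot' i μ = 0 → b.IsPos (w • i)) : v = w := by
  have hx : (w⁻¹ * v) • μ = μ := by rw [mul_smul, hvw, inv_smul_smul]
  suffices h : w⁻¹ * v = 1 by rw [inv_mul_eq_one] at h; exact h.symm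
  refine eq_one_of_forall_isPos b fun i hi => ?_
  by_contra hn
  have h1 : P.coroot' ((w⁻¹ * v) • i) μ = P.coroot' i μ := by
    conv_lhs => rw [← hx]
    exact coroot'_smul _ _ _
  have h2 := coroot'_nonpos_of_not_isPos b hμ hn
  have h3 : P.coroot' i μ = 0 := le_antisymm (h1 ▸ h2) (coroot'_simple_nonneg b hμ hi)
  have h4 : P.coroot' (negIdx P ((w⁻¹ * v) • i)) μ = 0 := by
    change P.toLinearMap μ (P.coroot _) = 0
    rw [coroot_negIdx, map_neg, neg_eq_zero]
    exact h1.trans h3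
  have h5 := isPos_smul_of_coroot'_eq_zero b hμ hw ((isPos_negIdx b _).2 hn) h4
  rw [smul_negIdx, isPos_negIdx, mul_smul, smul_inv_smul] at h5
  exact h5 (hv i hi h3)

/-- A sum over the Weyl group whose terms vanish outside the shortest coset representatives. -/
theorem sum_orbit_eq_sum_weylGroup {K : Type*} [Field K] {μ : M} (hμ : IsDominantWeight b μ)
    (f : ι → K) (hf : ∀ i ∈ b.support, P.coroot' i μ = 0 → f i = 0) :
    ∑ ν ∈ orbitFinset P μ, ∏ i ∈ inversions b (shortest b ν), f i =
      ∑ w : P.weylGroup, ∏ i ∈ inversions b w, f i := by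
  classical
  have hmem : ∀ w ∈ (Finset.univ : Finset P.weylGroup), w • μ ∈ orbitFinset P μ := fun w _ => by
    simp [orbitFinset]
  rw [← Finset.sum_fiberwise_of_maps_to hmem]
  refine Finset.sum_congr rfl fun ν hν => ?_
  have hν' : ∃ w : P.weylGroup, w • μ = ν := by simpa [orbitFinset] using hν
  have hs := shortest_spec b hμ hν'
  have hsμ : shortest b ν • μ = ν := by
    obtain ⟨w, hw⟩ := hν'
    have h1 := hs.1
    rw [← hw, ← mul_smul] at h1
    have h2 := dominant_smul_eq b hμ _ h1
    rw [mul_smul, hw] at h2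
    rw [eq_inv_smul_iff.1 h2.symm]
  symm
  refine Finset.sum_eq_single_of_mem (shortest b ν) (by simp [hsμ]) fun w hw hne => ?_
  have hwμ : w • μ = ν := (Finset.mem_filter.1 hw).2
  by_contra h0
  apply hne
  refine eq_of_smul_eq b hμ (hwμ.trans hsμ.symm) (fun i hi hiμ => ?_)
    (fun i hi hiμ => hs.isPos_smul b hsμ hi hiμ)
  by_contra hn
  exact h0 (Finset.prod_eq_zero (mem_inversions.2 ⟨b.isPos_of_mem_support hi, hn⟩) (hf i hi hiμ))

end Orbit

section QPower

variable [P.IsCrystallographic] [P.IsReduced] (b : P.Base) {K : Type*} [Field K]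

theorem qPow_simple {q : K} {u : ι → K} (hu : ∀ i, u i ≠ 0) (hinv : IsInvariant P u) {μ : M}
    {i : ι} (hi : i ∈ b.support) (hμ : P.coroot' i μ = 0) : qPow b q u μ i = u i ^ 2 := by
  have h1 : ∀ j, P.pairingIn ℤ (refl P i • j) i = -P.pairingIn ℤ j i := fun j => by
    have := pairing_refl_smul_left (P := P) i j
    rw [← P.algebraMap_pairingIn ℤ, ← P.algebraMap_pairingIn ℤ j] at this
    exact_mod_cast this
  rw [qPow, intPairing, hμ, Int.floor_zero, zpow_zero, one_mul,
    prod_posRoots_eq_of_refl b hi (fun j => u j ^ P.pairingIn ℤ j i) (fun j => by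
      rw [hinv, h1, ← zpow_add₀ (hu j), add_neg_cancel, zpow_zero]) (fun j hj => by
      have h2 := h1 j
      rw [hj] at h2
      have h3 : P.pairingIn ℤ j i = 0 := by omega
      rw [h3, zpow_zero]), P.pairingIn_same]
  exact zpow_ofNat _ 2

/-- `q ^ ⟨·, μ + ρ_k⟩` as a function on the coroot space. -/
noncomputable def qExp (q : K) (u : ι → K) (μ : M) (y : N) : K :=
  q ^ ⌊P.toLinearMap μ y⌋ * ∏ j ∈ posRoots b, u j ^ ⌊P.toLinearMap (P.root j) y⌋

theorem qExp_coroot (q : K) (u : ι → K) (μ : M) (i : ι) :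
    qExp b q u μ (P.coroot i) = qPow b q u μ i := by
  have h : ∀ j, ⌊P.toLinearMap (P.root j) (P.coroot i)⌋ = P.pairingIn ℤ j i := fun j => by
    have : P.toLinearMap (P.root j) (P.coroot i) = ((P.pairingIn ℤ j i : ℤ) : ℝ) :=
      (P.algebraMap_pairingIn ℤ j i).symm
    rw [this, Int.floor_intCast]
  simp only [qExp, qPow, h]
  rfl

theorem exists_toLinearMap_eq_intCast {μ : M} (hμ : IsDominantWeight b μ) {y : N}
    (hy : y ∈ corootLattice P) : ∃ n : ℤ, P.toLinearMap μ y = n := by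
  induction hy using AddSubgroup.closure_induction with
  | mem x hx =>
    obtain ⟨j, rfl⟩ := hx
    exact ⟨_, (intPairing_cast b hμ j).symm⟩
  | zero => exact ⟨0, by simp⟩
  | add x y _ _ hx hy =>
    obtain ⟨m, hm⟩ := hx
    obtain ⟨n, hn⟩ := hy
    exact ⟨m + n, by simp [hm, hn]⟩
  | neg x _ hx =>
    obtain ⟨m, hm⟩ := hx
    exact ⟨-m, by simp [hm]⟩

theorem isExponential_qExp {q : K} {u : ι → K} (hq : q ≠ 0) (hu : ∀ i, u i ≠ 0) {μ : M}
    (hμ : IsDominantWeight b μ) : IsExponential P (qExp b q u μ) where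
  zero := by simp [qExp]
  add x hx y hy := by
    obtain ⟨m, hm⟩ := exists_toLinearMap_eq_intCast b hμ hx
    have h : ∀ j, ⌊P.toLinearMap (P.root j) (x + y)⌋ =
        ⌊P.toLinearMap (P.root j) x⌋ + ⌊P.toLinearMap (P.root j) y⌋ := fun j => by
      obtain ⟨n, hn⟩ := exists_root'_eq_intCast hx j
      have hn' : P.toLinearMap (P.root j) x = n := hn
      rw [map_add, hn', Int.floor_intCast_add, Int.floor_intCast]
    simp only [qExp, h, zpow_add₀ (hu _), Finset.prod_mul_distrib]
    rw [map_add, hm, Int.floor_intCast_add, Int.floor_intCast, zpow_add₀ hq]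
    ring

theorem IsExponential.zpow {e : N → K} (he : IsExponential P e) (n : ℤ) :
    IsExponential P fun y => e y ^ n where
  zero := by simp [he.zero]
  add x hx y hy := by rw [he.add x hx y hy, mul_zpow]

theorem q_identity [P.IsRootSystem] [CharZero K] {μ : M} (hμ : IsDominantWeight b μ) (q : K)
    (u : ι → K) (hq : q ≠ 0) (hu : ∀ i, u i ≠ 0) (hinv : IsInvariant P u) (ε : ℤ)
    (hε : ε = 1 ∨ ε = -1)
    (hne : ∀ i ∈ posRoots b, 1 - u i ^ 2 * qPow b q u μ i ^ ε ≠ 0) :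
    ∑ ν ∈ orbitFinset P μ, ∏ i ∈ inversions b (shortest b ν),
        u i ^ 2 * (1 - (u i ^ 2)⁻¹ * qPow b q u μ i ^ ε) / (1 - u i ^ 2 * qPow b q u μ i ^ ε) =
      poincare b (fun i => u i ^ 2) *
        ∏ i ∈ posRoots b, (1 - qPow b q u μ i ^ ε) / (1 - u i ^ 2 * qPow b q u μ i ^ ε) := by
  have hu2 : ∀ i, u i ^ 2 ≠ 0 := fun i => pow_ne_zero 2 (hu i)
  have h0 : ∀ i, u i ^ 2 * (1 - (u i ^ 2)⁻¹ * qPow b q u μ i ^ ε) =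
      u i ^ 2 - qPow b q u μ i ^ ε := fun i => by
    rw [mul_sub, mul_one, mul_inv_cancel_left₀ (hu2 i)]
  simp only [h0]
  have hmain := sum_prod_inversions_eq b _ ((isExponential_qExp b hq hu hμ).zpow ε)
    (fun i => u i ^ 2) (fun w i => congrArg (· ^ 2) (hinv w i))
  simp only [qExp_coroot] at hmain
  rw [sum_orbit_eq_sum_weylGroup b hμ (fun i => (u i ^ 2 - qPow b q u μ i ^ ε) /
    (1 - u i ^ 2 * qPow b q u μ i ^ ε)), hmain hne]
  intro i hi hiμ
  have h1 := qPow_simple b (q := q) hu hinv hi hiμ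
  rcases hε with rfl | rfl
  · rw [h1, zpow_one, sub_self, zero_div]
  · refine absurd ?_ (hne i (mem_posRoots.2 (b.isPos_of_mem_support hi)))
    rw [h1, zpow_neg_one, mul_inv_cancel₀ (hu2 i), sub_self]

end QPower

section Limit

open Filter Topology

variable [P.IsCrystallographic] [P.IsReduced] (b : P.Base) [P.IsRootSystem]

theorem tendsto_exp_sub_one_div (a : ℝ) :
    Tendsto (fun h : ℝ => (Real.exp (h * a) - 1) / h) (𝓝[≠] 0) (𝓝 a) := by
  have h1 : HasDerivAt (fun h : ℝ => Real.exp (h * a)) (Real.exp (0 * a) * (1 * a)) 0 :=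
    ((hasDerivAt_id (0 : ℝ)).mul_const a).exp
  rw [hasDerivAt_iff_tendsto_slope_zero] at h1
  simpa [div_eq_inv_mul] using h1

theorem isExponential_exp (x : M) (h : ℝ) :
    IsExponential P fun y => Real.exp (h * P.toLinearMap x y) where
  zero := by simp
  add y _ z _ := by rw [map_add, mul_add, Real.exp_add]

theorem tendsto_exp_quotient {x k : ℝ} (hne : x + k ≠ 0) :
    Tendsto (fun h : ℝ => (Real.exp (h * k) - Real.exp (h * x)) /
      (1 - Real.exp (h * k) * Real.exp (h * x))) (𝓝[≠] 0) (𝓝 ((x - k) / (x + k))) := by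
  have h1 := ((tendsto_exp_sub_one_div x).sub (tendsto_exp_sub_one_div k)).div
    (tendsto_exp_sub_one_div (x + k)) hne
  refine h1.congr' ?_
  filter_upwards [self_mem_nhdsWithin] with h hh
  have hh' : h ≠ 0 := hh
  rw [Pi.div_apply, ← sub_div, div_div_div_cancel_right₀ hh', ← neg_div_neg_eq, mul_add,
    Real.exp_add]
  congr 1 <;> ring

theorem tendsto_exp_quotient_one {x k : ℝ} (hne : x + k ≠ 0) :
    Tendsto (fun h : ℝ => (1 - Real.exp (h * x)) /
      (1 - Real.exp (h * k) * Real.exp (h * x))) (𝓝[≠] 0) (𝓝 (x / (x + k))) := by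
  have h1 := (tendsto_exp_sub_one_div x).div (tendsto_exp_sub_one_div (x + k)) hne
  refine h1.congr' ?_
  filter_upwards [self_mem_nhdsWithin] with h hh
  have hh' : h ≠ 0 := hh
  rw [Pi.div_apply, div_div_div_cancel_right₀ hh', ← neg_div_neg_eq, mul_add,
    Real.exp_add]
  congr 1 <;> ring

theorem tendsto_poincare_exp (k : ι → ℝ) :
    Tendsto (fun h : ℝ => poincare b fun i => Real.exp (h * k i)) (𝓝[≠] 0)
      (𝓝 (Fintype.card P.weylGroup : ℝ)) := by
  have hc : Continuous fun h : ℝ => poincare b fun i => Real.exp (h * k i) := by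
    unfold poincare
    fun_prop
  have h0 := (hc.tendsto 0).mono_left (nhdsWithin_le_nhds (s := {0}ᶜ))
  simpa [poincare] using h0

/-- The rational degeneration of the identity `sum_prod_inversions_eq`. -/
theorem sum_prod_inversions_eq_rational {k : ι → ℝ} (hk : IsInvariant P k) (x : M)
    (hne : ∀ i ∈ posRoots b, P.coroot' i x + k i ≠ 0) :
    ∑ w : P.weylGroup, ∏ i ∈ inversions b w,
        (P.coroot' i x - k i) / (P.coroot' i x + k i) =
      (Fintype.card P.weylGroup : ℝ) *
        ∏ i ∈ posRoots b, P.coroot' i x / (P.coroot' i x + k i) := by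
  have hL := tendsto_finsetSum (Finset.univ : Finset P.weylGroup) fun w _ =>
    tendsto_finsetProd (inversions b w) fun i hi =>
      tendsto_exp_quotient (hne i (mem_posRoots.2 (mem_inversions.1 hi).1))
  have hR := (tendsto_poincare_exp b k).mul (tendsto_finsetProd (posRoots b) fun i hi =>
    tendsto_exp_quotient_one (hne i hi))
  refine tendsto_nhds_unique (hL.congr' ?_) hR
  filter_upwards [self_mem_nhdsWithin] with h hh
  refine sum_prod_inversions_eq b _ (isExponential_exp x h) (fun i => Real.exp (h * k i))
    (fun w i => congrArg (fun r => Real.exp (h * r)) (hk w i)) fun i hi h0 => ?_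
  rw [← Real.exp_add, ← mul_add, sub_eq_zero, eq_comm, Real.exp_eq_one_iff] at h0
  rcases mul_eq_zero.1 h0 with h0 | h0
  · exact hh h0
  · exact hne i hi (by rw [add_comm]; exact h0)

theorem rational_identity {μ : M} (hμ : IsDominantWeight b μ) {k : ι → ℝ} (hk : IsInvariant P k)
    (ε : ℤ) (hε : ε = 1 ∨ ε = -1)
    (hne : ∀ i ∈ posRoots b, P.coroot' i (μ + rho b k) + ε * k i ≠ 0) :
    ∑ ν ∈ orbitFinset P μ, ∏ i ∈ inversions b (shortest b ν),
        (P.coroot' i (μ + rho b k) - ε * k i) / (P.coroot' i (μ + rho b k) + ε * k i) =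
      (Fintype.card P.weylGroup : ℝ) * ∏ i ∈ posRoots b,
        P.coroot' i (μ + rho b k) / (P.coroot' i (μ + rho b k) + ε * k i) := by
  rw [sum_orbit_eq_sum_weylGroup b hμ (fun i => (P.coroot' i (μ + rho b k) - ε * k i) /
    (P.coroot' i (μ + rho b k) + ε * k i)),
    sum_prod_inversions_eq_rational b (k := fun i => ε * k i)
      (fun w i => congrArg (fun r => (ε : ℝ) * r) (hk w i)) _ hne]
  intro i hi hiμ
  have h1 : P.coroot' i (μ + rho b k) = k i := by
    rw [map_add, hiμ, zero_add, coroot'_rho_simple b hk hi]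
  rcases hε with rfl | rfl
  · rw [h1]
    simp
  · refine absurd ?_ (hne i (mem_posRoots.2 (b.isPos_of_mem_support hi)))
    rw [h1]
    simp

end Limit

section Denominators

variable [P.IsCrystallographic] [P.IsReduced] (b : P.Base)

theorem coroot'_add_pos {μ : M} (hμ : IsDominantWeight b μ) {k : ι → ℝ} (hk : IsInvariant P k)
    (h0 : ∀ i, 0 < k i) {i : ι} (hi : i ∈ posRoots b) :
    0 < P.coroot' i (μ + rho b k) + k i := by
  have hi' := mem_posRoots.1 hi
  have h1 := hμ.coroot'_nonneg b hi'
  have h2 := coroot'_rho_nonneg b hk (fun j => (h0 j).le) hi'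
  rw [map_add]
  linarith [h0 i]

theorem coroot'_add_pos_and_sub_pos {μ : M} (hμ : IsRegularDominantWeight b μ) {k : ι → ℝ}
    (hk : IsInvariant P k) (h0 : ∀ i, 0 ≤ k i) {i : ι} (hi : i ∈ posRoots b) :
    0 < P.coroot' i (μ + rho b k) + k i ∧ 0 < P.coroot' i (μ + rho b k) - k i := by
  obtain ⟨ν, hν, rfl⟩ := hμ
  have hi' := mem_posRoots.1 hi
  have h1 := hν.coroot'_nonneg b hi'
  have h2 := le_coroot'_rho b hk h0 hi'
  have h3 := le_coroot'_rho b (k := fun _ => 1) (fun _ _ => rfl) (fun _ => zero_le_one) hi'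
  rw [map_add, map_add]
  constructor <;> linarith [h0 i]

end Denominators

end HeckmanOpdam

theorem mainTheorem7 {ι M N : Type*} [Fintype ι] [AddCommGroup M] [Module ℝ M]
    [AddCommGroup N] [Module ℝ N] (P : RootPairing ι ℝ M N)
    [P.IsRootSystem] [P.IsCrystallographic] [P.IsReduced] [P.IsIrreducible]
    (b : P.Base) (μ : M) (hμ : HeckmanOpdam.IsDominantWeight b μ) :
    -- the identity for `k_α`, with `ε = ±1` the choice of the sign
    (∀ k : ι → ℝ, HeckmanOpdam.IsInvariant P k →
      (∀ ε : ℤ, ε = 1 ∨ ε = -1 →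
        (∀ i ∈ HeckmanOpdam.posRoots b,
          P.coroot' i (μ + HeckmanOpdam.rho b k) + ε * k i ≠ 0) →
        ∑ ν ∈ HeckmanOpdam.orbitFinset P μ,
            ∏ i ∈ HeckmanOpdam.inversions b (HeckmanOpdam.shortest b ν),
              (P.coroot' i (μ + HeckmanOpdam.rho b k) - ε * k i) /
                (P.coroot' i (μ + HeckmanOpdam.rho b k) + ε * k i) =
          (Fintype.card P.weylGroup : ℝ) *
            ∏ i ∈ HeckmanOpdam.posRoots b,
              P.coroot' i (μ + HeckmanOpdam.rho b k) /
                (P.coroot' i (μ + HeckmanOpdam.rho b k) + ε * k i)) ∧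
      -- cases in which the denominators do not vanish
      ((∀ i, 0 < k i) → ∀ i ∈ HeckmanOpdam.posRoots b,
        0 < P.coroot' i (μ + HeckmanOpdam.rho b k) + k i) ∧
      ((∀ i, 0 ≤ k i) → HeckmanOpdam.IsRegularDominantWeight b μ →
        ∀ i ∈ HeckmanOpdam.posRoots b,
          0 < P.coroot' i (μ + HeckmanOpdam.rho b k) + k i ∧
          0 < P.coroot' i (μ + HeckmanOpdam.rho b k) - k i)) ∧
    -- the `q`-identity, with `t_α = u_α ^ 2`
    (∀ (K : Type*) [Field K] [CharZero K] (q : K) (u : ι → K), q ≠ 0 → (∀ i, u i ≠ 0) →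
      HeckmanOpdam.IsInvariant P u →
      ∀ ε : ℤ, ε = 1 ∨ ε = -1 →
        (∀ i ∈ HeckmanOpdam.posRoots b,
          1 - u i ^ 2 * HeckmanOpdam.qPow b q u μ i ^ ε ≠ 0) →
        ∑ ν ∈ HeckmanOpdam.orbitFinset P μ,
            ∏ i ∈ HeckmanOpdam.inversions b (HeckmanOpdam.shortest b ν),
              u i ^ 2 * (1 - (u i ^ 2)⁻¹ * HeckmanOpdam.qPow b q u μ i ^ ε) /
                (1 - u i ^ 2 * HeckmanOpdam.qPow b q u μ i ^ ε) =
          HeckmanOpdam.poincare b (fun i => u i ^ 2) *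
            ∏ i ∈ HeckmanOpdam.posRoots b,
              (1 - HeckmanOpdam.qPow b q u μ i ^ ε) /
                (1 - u i ^ 2 * HeckmanOpdam.qPow b q u μ i ^ ε)) := by
  exact ⟨fun k hk => ⟨fun ε hε hne => HeckmanOpdam.rational_identity b hμ hk ε hε hne,
    fun h0 _ hi => HeckmanOpdam.coroot'_add_pos b hμ hk h0 hi,
    fun h0 hreg _ hi => HeckmanOpdam.coroot'_add_pos_and_sub_pos b hreg hk h0 hi⟩,
    fun _ _ _ q u hq hu hinv ε hε hne =>
      HeckmanOpdam.q_identity b hμ q u hq hu hinv ε hε hne⟩
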